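/- Let $S\subset\mathbb R^d$ be compact with Hausdorff dimension an integer $d'$, $0<d'\le d$. Write $B(A,t)$ for the closed $t$-parallel set of $A$, $\mu$ for Lebesgue measure, $V(t)=\mu(B(S,t))$, and let $\mathbf R=\sup\{t\ge 0: V \text{ is a polynomial of degree at most } d \text{ on } [0,t]\}$ be the polynomial reach of $S$. Let $X_1,X_2,\dots$ be i.i.d. with law $P_X$ whose support is $S$, and assume that $P_X$ is standard in dimension $d'$: there are $\delta,\lambda>0$ with $P_X(B(x,\varepsilon)\cap S)\ge \delta\,\omega_{d'}\varepsilon^{d'}$ for all $x\in S$ and $0<\varepsilon\le\lambda$, where $\omega_{d'}$ is the volume of the unit ball of $\mathbb R^{d'}$. Put $V_n(t)=\mu(B(\{X_1,\dots,X_n\},t))$. For an interval $I$ and $m\in\mathbb N$ let $P^I_{n,m}$ be the best $L^2(I)$ approximation of $V_n$ by polynomials of degree at most $m$. Algorithm. Fix a grid $0=r_0<r_1<\dots<r_K$, a degree $\ell\ge d$, a number $\eta>0$, and put $U_n=(\log n/n)^{\frac1{2d}-\eta}$. If $\|V_n-P^{[0,r_1]}_{n,d}\|_{L^2([0,r_1])}>U_n$,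 the output is $\widehat{\mathbf R}=0$. Otherwise, for $1\le i\le K-1$ let $$c_i=\frac{\|V_n-P^{[0,r_i]}_{n,d}\|_{L^2([0,r_i])}}{\|V_n-P^{[r_i,r_K]}_{n,\ell}\|_{L^2([r_i,r_K])}}\in[0,\infty]$$ (with $a/0=\infty$ for $a>0$ and $0/0=0$); the output is $\widehat{\mathbf R}=r_{i-1}$ for the first $i$ with $c_i>1$, and $\widehat{\mathbf R}=r_{K-1}$ if there is no such $i$. Theorem. Assume $r_{i_0}<\mathbf R<r_{i_0+1}$ for some $2\le i_0\le K-1$. Let $\theta_0,\dots,\theta_d$ be the coefficients of $V$, i.e. the (existing) reals with $V(t)=\sum_{i=0}^d\theta_it^i$ for $0\le t<\mathbf R$. Then there is $\ell_0\ge d$ such that for every degree $\ell\ge\ell_0$ and every $\eta>0$ the coefficients $\theta_{0n},\dots,\theta_{dn}$ of $P^{[r_1,\widehat{\mathbf R}]}_{n,d}$ satisfy, with probability one, $$\max_{0\le i\le d}|\theta_i-\theta_{in}|=O\Big(\Big(\frac{\log n}{n}\Big)^{1/d'}\Big)\qquad(n\to\infty).$$ (If $[r_1,\widehat{\mathbf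 R}]$ is empty or a single point, the fit is an arbitrary polynomial of degree at most $d$; almost surely this happens for only finitely many $n$.) -/

import Mathlib

open MeasureTheory ProbabilityTheory Filter Topology Asymptotics

noncomputable section

/-- The volume function `V(t) = μ(B(S, t))`, `t ≥ 0`, of a set `S ⊆ ℝᵈ`, where `B(S, t)` is the
closed `t`-parallel set and `μ` is Lebesgue measure. -/
def volFun {d : ℕ} (S : Set (EuclideanSpace ℝ (Fin d))) (t : ℝ) : ℝ :=
  (volume (Metric.cthickening t S)).toReal

/-- The polynomial reach of `S`: the supremum, in `[0, ∞]`, of the `t ≥ 0` such that the volume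
function agrees on `[0, t]` with a polynomial of degree at most `d`. -/
def polyReach {d : ℕ} (S : Set (EuclideanSpace ℝ (Fin d))) : EReal :=
  sSup ((fun t : ℝ => (t : EReal)) '' {t : ℝ | 0 ≤ t ∧
    ∃ p : Polynomial ℝ, p.natDegree ≤ d ∧ ∀ s ∈ Set.Icc 0 t, volFun S s = p.eval s})

/-- `S` is standard in dimension `k` with respect to `ν`: for some `δ, r₀ > 0`, every `x ∈ S` and
`0 < ε ≤ r₀` satisfy `ν(B(x, ε) ∩ S) ≥ δ ω_k ε ^ k`. Here `ω_k ε ^ k` is written as the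
`k`-dimensional measure of a `k`-dimensional ball of radius `ε`. -/
def IsStandard {d : ℕ} (S : Set (EuclideanSpace ℝ (Fin d)))
    (ν : Measure (EuclideanSpace ℝ (Fin d))) (k : ℕ) : Prop :=
  ∃ δ : ℝ, 0 < δ ∧ ∃ r₀ : ℝ, 0 < r₀ ∧ ∀ x ∈ S, ∀ ε : ℝ, 0 < ε → ε ≤ r₀ →
    ENNReal.ofReal δ * volume (Metric.closedBall (0 : EuclideanSpace ℝ (Fin k)) ε)
      ≤ ν (Metric.closedBall x ε ∩ S)

/-- The `L²(I)` distance between `f` and a polynomial. -/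
def fitError (f : ℝ → ℝ) (I : Set ℝ) (p : Polynomial ℝ) : ENNReal :=
  eLpNorm (fun t => f t - p.eval t) 2 (volume.restrict I)

/-- `p` minimises `‖f - q‖_{L²(I)}` over the polynomials `q` of degree at most `m`. -/
def IsBestPoly (m : ℕ) (f : ℝ → ℝ) (I : Set ℝ) (p : Polynomial ℝ) : Prop :=
  p.natDegree ≤ m ∧ ∀ q : Polynomial ℝ, q.natDegree ≤ m → fitError f I p ≤ fitError f I q

/-- The best `L²(I)` approximation of `f` by polynomials of degree at most `m`. For `f ∈ L²(I)` and
an interval `I` of positive length it exists and is unique. -/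
def bestPoly (m : ℕ) (f : ℝ → ℝ) (I : Set ℝ) : Polynomial ℝ :=
  Classical.epsilon (IsBestPoly m f I)

/-- The ratio `c_i` of the `L²` error of the fit of degree `d` on `[0, r_i]` to that of the fit of
degree `l` on `[r_i, r_K]`, with values in `[0, ∞]` (so `a / 0 = ∞` for `a ≠ 0`, and `0 / 0 = 0`). -/
def algRatio (d l K : ℕ) (r : ℕ → ℝ) (f : ℝ → ℝ) (i : ℕ) : ENNReal :=
  fitError f (Set.Icc 0 (r i)) (bestPoly d f (Set.Icc 0 (r i))) /
    fitError f (Set.Icc (r i) (r K)) (bestPoly l f (Set.Icc (r i) (r K)))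

open Classical in
/-- The output of the algorithm for the (empirical) volume function `f`, with threshold `U`, grid
`0 = r 0 < r 1 < ⋯ < r K` and auxiliary degree `l`: it is `0` if the fit of degree `d` on `[0, r 1]`
has error `> U`; otherwise it is `r (i - 1)` for the first `i ∈ {1, …, K - 1}` with `c_i > 1`, or
`r (K - 1)` if there is no such `i`. -/
def algOutput (d l K : ℕ) (r : ℕ → ℝ) (U : ℝ) (f : ℝ → ℝ) : ℝ :=
  if ENNReal.ofReal U < fitError f (Set.Icc 0 (r 1)) (bestPoly d f (Set.Icc 0 (r 1))) then 0
  else if h : ∃ i : ℕ, 1 ≤ i ∧ i < K ∧ 1 < algRatio d l K r f i then r (Nat.find h - 1)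
  else r (K - 1)

/-- The set `{X₁(ω), …, X_n(ω)}` of the first `n` sample points. -/
def sampleSet {d : ℕ} {Ω : Type*} (X : ℕ → Ω → EuclideanSpace ℝ (Fin d)) (n : ℕ) (ω : Ω) :
    Set (EuclideanSpace ℝ (Fin d)) :=
  (fun i => X i ω) '' Set.Iio n

/-- The threshold `U_n = (log n / n) ^ (1 / (2 d) - η)`. -/
def algThreshold (d : ℕ) (η : ℝ) (n : ℕ) : ℝ :=
  (Real.log n / n) ^ (1 / (2 * (d : ℝ)) - η)

/-- The output of the algorithm on the sample of size `n`. -/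
def reachEstimate {d : ℕ} {Ω : Type*} (X : ℕ → Ω → EuclideanSpace ℝ (Fin d))
    (l K : ℕ) (r : ℕ → ℝ) (η : ℝ) (n : ℕ) (ω : Ω) : ℝ :=
  algOutput d l K r (algThreshold d η n) (volFun (sampleSet X n ω))

/-- The polynomial fitted to the empirical volume function `V_n` on `[r 1, R̂]`, where `R̂` is the
output of the algorithm. -/
def fittedPoly {d : ℕ} {Ω : Type*} (X : ℕ → Ω → EuclideanSpace ℝ (Fin d))
    (l K : ℕ) (r : ℕ → ℝ) (η : ℝ) (n : ℕ) (ω : Ω) : Polynomial ℝ :=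
  bestPoly d (volFun (sampleSet X n ω)) (Set.Icc (r 1) (reachEstimate X l K r η n ω))

end

/-!
Let `ε` be the Hausdorff distance between the sample and `S`. Since the law is standard in dimension
`d'`, a union bound over a maximal separated subset of `S` together with the Borel-Cantelli lemma
gives, almost surely, `ε = O((log n / n) ^ (1 / d'))`
(`ae_eventually_subset_cthickening_sampleSet`). Everything else is deterministic and rests on the
sandwich `V (t - ε) ≤ V_n t ≤ V t` for `t ≥ ε`.

* As `V` is monotone, the sandwich makes `∫₀ᵇ (V - V_n)` a telescoping integral of order `ε`, whence
  `‖V_n - V‖ = O(√ε)` in `L²([0, b])` (`eLpNorm_sub_le_of_shift_le`). No regularity of `V` beyond the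
  reach is needed.
* The error of the best approximation is `1`-Lipschitz in the approximated function, so the errors
  computed by the algorithm converge to those for `V`. On `[0, r i]` with `r i` below the reach the
  limit is `0`, and the rate `√ε` on `[0, r 1]` is below the threshold. On
  `[r i, r K]` with `i ≤ i₀` the limit is
  positive for every degree: if `V` were a polynomial there, it would be the one representing `V`
  below the reach, and the reach would be at least `r K` (`le_polyReach_of_ae_eq`). For the same
  reason the error of degree `d` on `[0, r (i₀ + 1)]` has a positive limit, which, polynomials being
  dense in `L²`, exceeds the limit of the error of degree `l` on `[r (i₀ + 1), r K]` once `l` is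
  large. Hence the output is eventually one of `r 2, …, r i₀`
  (`eventually_exists_algOutput_eq`).
* On `[r 1, r j]` with `2 ≤ j ≤ i₀` the function `V` is a polynomial, hence Lipschitz, and the
  sandwich gives `V_n - V = O(ε)`. Since all norms on the polynomials of degree at most `d` are
  equivalent, the coefficients of the fit are within `O(ε)` of those of `V`
  (`exists_abs_coeff_sub_coeff_bestPoly_volFun_le`).
-/

/-! ### Random covering -/

/-- A maximal `2ε`-separated subset of `S` covers `S` at scale `2ε`, and it is small because the
balls of radius `ε` around its points are disjoint and each of them carries mass at least `q`. -/
lemma exists_finset_cover_of_le_measure {E : Type*} [MetricSpace E] [MeasurableSpace E]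
    [OpensMeasurableSpace E] {ν : Measure E} [IsProbabilityMeasure ν] {S : Set E} {ε q : ℝ}
    (hq : 0 < q) (hball : ∀ x ∈ S, ENNReal.ofReal q ≤ ν (Metric.closedBall x ε)) :
    ∃ T : Finset E, (T : Set E) ⊆ S ∧ (T.card : ℝ) * q ≤ 1 ∧ ∀ x ∈ S, ∃ y ∈ T,
      dist x y ≤ 2 * ε := by
  classical
  let Sep : Finset E → Prop := fun T =>
    (T : Set E) ⊆ S ∧ (T : Set E).Pairwise fun x y => 2 * ε < dist x y
  have hcard : ∀ T, Sep T → (T.card : ℝ) * q ≤ 1 := by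
    intro T hT
    have hdisj : (T : Set E).PairwiseDisjoint fun x => Metric.closedBall x ε := by
      intro x hx y hy hxy
      exact Metric.closedBall_disjoint_closedBall (by linarith [hT.2 hx hy hxy])
    have h1 : ∑ x ∈ T, ν (Metric.closedBall x ε) ≤ 1 := by
      rw [← measure_biUnion_finset hdisj fun x _ => Metric.isClosed_closedBall.measurableSet]
      exact prob_le_one
    have h2 : (T.card : ENNReal) * ENNReal.ofReal q ≤ 1 := by
      refine le_trans ?_ h1
      rw [← nsmul_eq_mul]
      exact Finset.card_nsmul_le_sum _ _ _ fun x hx => hball x (hT.1 hx)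
    rw [← ENNReal.ofReal_natCast, ← ENNReal.ofReal_mul (by positivity), ENNReal.ofReal_le_one]
      at h2
    exact h2
  let A : Set ℕ := {k | ∃ T, Sep T ∧ T.card = k}
  have hA : A.Nonempty := ⟨0, ∅, ⟨by simp, by simp⟩, rfl⟩
  have hbdd : BddAbove A := by
    refine ⟨⌊1 / q⌋₊, ?_⟩
    rintro k ⟨T, hT, rfl⟩
    exact Nat.le_floor ((le_div_iff₀ hq).2 (hcard T hT))
  obtain ⟨T, hT, hTA⟩ := Nat.sSup_mem hA hbdd
  refine ⟨T, hT.1, hcard T hT, fun x hx => ?_⟩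
  by_contra! hfar
  have hxT : x ∉ T := fun h => by
    have h0 := hfar x h
    have h1 : ENNReal.ofReal q ≤ ν (Metric.closedBall x ε) := hball x hx
    rw [Metric.closedBall_eq_empty.2 (by simp at h0; linarith), measure_empty] at h1
    simp at h1
    linarith
  have hins : Sep (insert x T) := by
    refine ⟨by simpa [Set.insert_subset_iff] using ⟨hx, hT.1⟩, ?_⟩
    rw [Finset.coe_insert]
    refine hT.2.insert_of_notMem (by simpa using hxT) fun y hy => ?_
    exact ⟨hfar y hy, by rw [dist_comm]; exact hfar y hy⟩
  have := le_csSup hbdd ⟨insert x T, hins, rfl⟩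
  rw [Finset.card_insert_of_notMem hxT, hTA] at this
  omega

section Sample

variable {d : ℕ} {Ω : Type*} [MeasurableSpace Ω] {P : Measure Ω}
  {X : ℕ → Ω → EuclideanSpace ℝ (Fin d)}

lemma measure_forall_notMem_le [IsProbabilityMeasure P]
    (hXmeas : ∀ n, Measurable (X n)) (hXindep : iIndepFun X P)
    (hXident : ∀ n, IdentDistrib (X n) (X 0) P P) {B : Set (EuclideanSpace ℝ (Fin d))}
    (hB : MeasurableSet B) {q : ℝ} (hq : ENNReal.ofReal q ≤ P.map (X 0) B)
    (n : ℕ) : P {ω | ∀ i < n, X i ω ∉ B} ≤ ENNReal.ofReal (Real.exp (-(n * q))) := by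
  have h1 : {ω | ∀ i < n, X i ω ∉ B} = ⋂ i ∈ Finset.range n, X i ⁻¹' Bᶜ := by
    ext ω; simp
  have hcompl : ∀ i, P (X i ⁻¹' Bᶜ) ≤ ENNReal.ofReal (Real.exp (-q)) := by
    intro i
    rw [(hXident i).measure_preimage_eq hB.compl, ← Measure.map_apply (hXmeas 0) hB.compl]
    have : IsProbabilityMeasure (P.map (X 0)) :=
      Measure.isProbabilityMeasure_map (hXmeas 0).aemeasurable
    rw [prob_compl_eq_one_sub hB]
    calc 1 - P.map (X 0) B ≤ 1 - ENNReal.ofReal q := tsub_le_tsub_left hq _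
      _ ≤ ENNReal.ofReal (1 - q) := by
        rw [tsub_le_iff_right]
        calc (1 : ENNReal) = ENNReal.ofReal (1 - q + q) := by simp
          _ ≤ _ := ENNReal.ofReal_add_le
      _ ≤ _ := ENNReal.ofReal_le_ofReal (Real.one_sub_le_exp_neg q)
  rw [h1, hXindep.measure_inter_preimage_eq_mul (Finset.range n) fun i _ => hB.compl]
  calc ∏ i ∈ Finset.range n, P (X i ⁻¹' Bᶜ)
      ≤ ∏ _i ∈ Finset.range n, ENNReal.ofReal (Real.exp (-q)) :=
        Finset.prod_le_prod' fun i _ => hcompl i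
    _ = ENNReal.ofReal (Real.exp (-(n * q))) := by
        rw [Finset.prod_const, Finset.card_range, ← ENNReal.ofReal_pow (Real.exp_pos _).le,
          ← Real.exp_nat_mul]
        ring_nf

/-- Union bound over a covering of `S` by at most `1 / q` balls of radius `2ε`: if each of the
concentric balls of radius `ε` contains a sample point, then `S` lies within `3ε` of the sample. -/
lemma measure_not_subset_cthickening_le [IsProbabilityMeasure P]
    (hXmeas : ∀ n, Measurable (X n))
    (hXindep : iIndepFun X P) (hXident : ∀ n, IdentDistrib (X n) (X 0) P P)
    {S : Set (EuclideanSpace ℝ (Fin d))} {ε q : ℝ} (hq : 0 < q)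
    (hball : ∀ x ∈ S, ENNReal.ofReal q ≤ P.map (X 0) (Metric.closedBall x ε)) (n : ℕ) :
    P {ω | ¬ S ⊆ Metric.cthickening (3 * ε) (sampleSet X n ω)}
      ≤ ENNReal.ofReal (1 / q * Real.exp (-(n * q))) := by
  have : IsProbabilityMeasure (P.map (X 0)) :=
    Measure.isProbabilityMeasure_map (hXmeas 0).aemeasurable
  obtain ⟨T, hTS, hcard, hcover⟩ := exists_finset_cover_of_le_measure hq hball
  have hsub : {ω | ¬ S ⊆ Metric.cthickening (3 * ε) (sampleSet X n ω)}
      ⊆ ⋃ y ∈ T, {ω | ∀ i < n, X i ω ∉ Metric.closedBall y ε} := by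
    intro ω hω
    by_contra hcon
    simp only [Set.mem_iUnion, Set.mem_ofPred_eq, not_exists, not_forall, not_not] at hcon
    refine hω fun x hx => ?_
    obtain ⟨y, hy, hxy⟩ := hcover x hx
    obtain ⟨i, hi, hiy⟩ := hcon y hy
    refine Metric.mem_cthickening_of_dist_le x (X i ω) _ _ ⟨i, hi, rfl⟩ ?_
    have h1 := dist_triangle x y (X i ω)
    rw [Metric.mem_closedBall, dist_comm] at hiy
    linarith
  calc _ ≤ _ := measure_mono hsub
    _ ≤ ∑ y ∈ T, P {ω | ∀ i < n, X i ω ∉ Metric.closedBall y ε} := measure_biUnion_finset_le _ _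
    _ ≤ T.card • ENNReal.ofReal (Real.exp (-(n * q))) :=
        Finset.sum_le_card_nsmul _ _ _ fun y hy =>
          measure_forall_notMem_le hXmeas hXindep hXident
            Metric.isClosed_closedBall.measurableSet (hball y (hTS hy)) n
    _ = ENNReal.ofReal (T.card * Real.exp (-(n * q))) := by
        rw [nsmul_eq_mul, ENNReal.ofReal_mul (by positivity), ENNReal.ofReal_natCast]
    _ ≤ _ := ENNReal.ofReal_le_ofReal <| by
        gcongr
        exact (le_div_iff₀ hq).2 hcard

lemma tendsto_log_div_rpow_zero {s : ℝ} (hs : 0 < s) :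
    Tendsto (fun n : ℕ => (Real.log n / n) ^ s) atTop (𝓝 0) := by
  have h : Tendsto (fun n : ℕ => Real.log n / n) atTop (𝓝 0) :=
    (Real.isLittleO_log_id_atTop.tendsto_div_nhds_zero).comp tendsto_natCast_atTop_atTop
  simpa [Real.zero_rpow hs.ne'] using h.rpow_const (p := s) (Or.inr hs.le)

lemma log_div_pos {n : ℕ} (hn : 2 ≤ n) : 0 < Real.log n / n := by
  have : (2 : ℝ) ≤ n := by exact_mod_cast hn
  have := Real.log_pos (by linarith : (1 : ℝ) < n)
  positivity

/-- Almost surely the sample of size `n` is eventually `O((log n / n) ^ (1 / k))`-dense in a set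
that is standard in dimension `k`. -/
lemma ae_eventually_subset_cthickening_sampleSet [IsProbabilityMeasure P]
    (hXmeas : ∀ n, Measurable (X n))
    (hXindep : iIndepFun X P) (hXident : ∀ n, IdentDistrib (X n) (X 0) P P)
    {S : Set (EuclideanSpace ℝ (Fin d))} {k : ℕ} (hk : 0 < k)
    (hstd : IsStandard S (P.map (X 0)) k) :
    ∃ C : ℝ, 0 < C ∧ ∀ᵐ ω ∂P, ∀ᶠ n : ℕ in atTop,
      S ⊆ Metric.cthickening (C * (Real.log n / n) ^ (1 / (k : ℝ))) (sampleSet X n ω) := by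
  obtain ⟨δ, hδ, r₀, hr₀, hball⟩ := hstd
  have : Nonempty (Fin k) := ⟨⟨0, hk⟩⟩
  obtain ⟨v, hv, hvol⟩ : ∃ v : ℝ, 0 < v ∧ ∀ ε : ℝ, 0 < ε →
      volume (Metric.closedBall (0 : EuclideanSpace ℝ (Fin k)) ε) = ENNReal.ofReal (ε ^ k * v) := by
    refine ⟨√Real.pi ^ k / Real.Gamma ((k : ℝ) / 2 + 1), ?_, fun ε hε => ?_⟩
    · have := Real.Gamma_pos_of_pos (by positivity : (0 : ℝ) < (k : ℝ) / 2 + 1)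
      have := Real.pi_pos
      positivity
    · rw [EuclideanSpace.volume_closedBall, Fintype.card_fin, ← ENNReal.ofReal_pow hε.le,
        ← ENNReal.ofReal_mul (by positivity)]
  have hc : 0 < δ * v := by positivity
  -- The constant for which the mass of a ball of radius `ε n` is at least `3 * log n / n`.
  set a : ℝ := (3 / (δ * v)) ^ (1 / (k : ℝ)) with ha
  have ha0 : 0 < a := by positivity
  have hak : a ^ k = 3 / (δ * v) := by
    rw [ha, one_div, Real.rpow_inv_natCast_pow (by positivity) hk.ne']
  set ε : ℕ → ℝ := fun n => a * (Real.log n / n) ^ (1 / (k : ℝ)) with hε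
  have hεlim : Tendsto ε atTop (𝓝 0) := by
    simpa [hε] using (tendsto_log_div_rpow_zero (s := 1 / (k : ℝ)) (by positivity)).const_mul a
  have hbound : ∀ᶠ n : ℕ in atTop,
      P {ω | ¬ S ⊆ Metric.cthickening (3 * ε n) (sampleSet X n ω)}
        ≤ ENNReal.ofReal (1 / (n : ℝ) ^ 2) := by
    filter_upwards [hεlim.eventually (gt_mem_nhds hr₀), eventually_ge_atTop 2] with n hn hn2
    have hL := log_div_pos hn2
    have hn2' : (2 : ℝ) ≤ n := by exact_mod_cast hn2
    have hεpos : 0 < ε n := by positivity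
    set q : ℝ := 3 * (Real.log n / n) with hqdef
    have hq : 0 < q := by positivity
    have hq' : δ * ((ε n) ^ k * v) = q := by
      rw [hε]
      simp only
      rw [mul_pow, hak, one_div, Real.rpow_inv_natCast_pow hL.le hk.ne', hqdef]
      field_simp
    have hb : ∀ x ∈ S, ENNReal.ofReal q ≤ P.map (X 0) (Metric.closedBall x (ε n)) := by
      intro x hx
      have := hball x hx (ε n) hεpos hn.le
      rw [hvol _ hεpos, ← ENNReal.ofReal_mul hδ.le, hq'] at this
      exact this.trans (measure_mono Set.inter_subset_left)
    refine (measure_not_subset_cthickening_le hXmeas hXindep hXident hq hb n).trans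
      (ENNReal.ofReal_le_ofReal ?_)
    have hexp : Real.exp (-(n * q)) = 1 / (n : ℝ) ^ 3 := by
      have : (n : ℝ) * q = 3 * Real.log n := by rw [hqdef]; field_simp
      rw [this, Real.exp_neg, one_div, show (3 : ℝ) * Real.log n = (3 : ℕ) * Real.log n by simp,
        Real.exp_nat_mul, Real.exp_log (by linarith)]
    have hqn : 1 / q ≤ n := by
      rw [div_le_iff₀ hq]
      have h2 : Real.log 2 ≤ Real.log n := Real.log_le_log (by norm_num) hn2'
      have h3 : (n : ℝ) * q = 3 * Real.log n := by rw [hqdef]; field_simp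
      rw [h3]
      linarith [Real.log_two_gt_d9]
    rw [hexp]
    calc 1 / q * (1 / (n : ℝ) ^ 3) ≤ n * (1 / (n : ℝ) ^ 3) := by gcongr
      _ = 1 / (n : ℝ) ^ 2 := by field_simp
  refine ⟨3 * a, by positivity, ?_⟩
  obtain ⟨N, hN⟩ := eventually_atTop.1 hbound
  have hsum : ∑' n, P {ω | ¬ S ⊆ Metric.cthickening (3 * ε (n + N)) (sampleSet X (n + N) ω)}
      ≠ ⊤ := by
    have hs : Summable fun n : ℕ => 1 / ((n + N : ℕ) : ℝ) ^ 2 :=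
      (summable_nat_add_iff N).2 (Real.summable_one_div_nat_pow.2 one_lt_two)
    refine ne_top_of_le_ne_top hs.tsum_ofReal_ne_top (ENNReal.tsum_le_tsum fun n => ?_)
    exact hN (n + N) (Nat.le_add_left _ _)
  filter_upwards [ae_eventually_notMem hsum] with ω hω
  have := (eventually_atTop.1 hω)
  obtain ⟨M, hM⟩ := this
  refine eventually_atTop.2 ⟨M + N, fun n hn => ?_⟩
  have h := hM (n - N) (by omega)
  simp only [not_not, Nat.sub_add_cancel (by omega : N ≤ n)] at h
  rw [mul_assoc]
  exact h

/-- Almost surely all sample points lie in the support of their law. -/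
lemma ae_sampleSet_subset (hXmeas : ∀ n, Measurable (X n))
    (hXident : ∀ n, IdentDistrib (X n) (X 0) P P) {S : Set (EuclideanSpace ℝ (Fin d))}
    (hsupp : (P.map (X 0)).support = S) : ∀ᵐ ω ∂P, ∀ n, sampleSet X n ω ⊆ S := by
  have h : ∀ i, ∀ᵐ ω ∂P, X i ω ∈ S := by
    intro i
    have h1 : ∀ᵐ x ∂(P.map (X i)), x ∈ S := by
      rw [(hXident i).map_eq, ← hsupp]
      exact Measure.support_mem_ae
    exact ae_of_ae_map (hXmeas i).aemeasurable h1
  filter_upwards [ae_all_iff.2 h] with ω hω n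
  rintro _ ⟨i, -, rfl⟩
  exact hω i

end Sample

/-! ### Best polynomial approximation in `L²` -/

lemma fitError_eq_eLpNorm_sub (f : ℝ → ℝ) (I : Set ℝ) (p : Polynomial ℝ) :
    fitError f I p = eLpNorm (f - fun t => p.eval t) 2 (volume.restrict I) := rfl

lemma memLp_eval (p : Polynomial ℝ) (a b : ℝ) :
    MemLp (fun t => p.eval t) 2 (volume.restrict (Set.Icc a b)) := by
  obtain ⟨C, hC⟩ := isCompact_Icc.exists_bound_of_continuousOn
    (p.continuous.continuousOn (s := Set.Icc a b))
  exact MemLp.of_bound p.continuous.aestronglyMeasurable C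
    ((ae_restrict_iff' measurableSet_Icc).2 (Eventually.of_forall hC))

/-- The linear map sending a polynomial to its class in `L²([a, b])`. -/
noncomputable def polyToLp (a b : ℝ) :
    Polynomial ℝ →ₗ[ℝ] Lp ℝ 2 (volume.restrict (Set.Icc a b)) where
  toFun p := (memLp_eval p a b).toLp
  map_add' p q := by
    rw [← MemLp.toLp_add]
    congr 1
    ext t
    simp
  map_smul' c p := by
    rw [RingHom.id_apply, ← MemLp.toLp_const_smul]
    congr 1
    ext t
    simp

lemma fitError_eq_norm {f : ℝ → ℝ} {a b : ℝ} (hf : MemLp f 2 (volume.restrict (Set.Icc a b)))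
    (p : Polynomial ℝ) :
    fitError f (Set.Icc a b) p = ENNReal.ofReal ‖hf.toLp - polyToLp a b p‖ := by
  have : polyToLp a b p = (memLp_eval p a b).toLp := rfl
  rw [this, ← MemLp.toLp_sub, Lp.norm_toLp,
    ENNReal.ofReal_toReal (hf.sub (memLp_eval p a b)).eLpNorm_ne_top]
  rfl

lemma fitError_ne_top {f : ℝ → ℝ} {a b : ℝ} (hf : MemLp f 2 (volume.restrict (Set.Icc a b)))
    (p : Polynomial ℝ) : fitError f (Set.Icc a b) p ≠ ⊤ :=
  (hf.sub (memLp_eval p a b)).eLpNorm_ne_top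

lemma mem_degreeLT_succ_iff {p : Polynomial ℝ} {m : ℕ} :
    p ∈ Polynomial.degreeLT ℝ (m + 1) ↔ p.natDegree ≤ m := by
  rw [Polynomial.mem_degreeLT, Polynomial.natDegree_le_iff_degree_le, Nat.cast_succ,
    ← Nat.cast_succ, Polynomial.degree_lt_iff_coeff_zero, Polynomial.degree_le_iff_coeff_zero]
  simp

lemma finiteDimensional_degreeLT (m : ℕ) :
    FiniteDimensional ℝ (Polynomial.degreeLT ℝ m) :=
  Module.Finite.equiv (Polynomial.degreeLTEquiv ℝ m).symm

/-- The best polynomial approximation is attained, as an orthogonal projection in `L²([a, b])`. -/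
lemma isBestPoly_bestPoly {f : ℝ → ℝ} {a b : ℝ} (m : ℕ)
    (hf : MemLp f 2 (volume.restrict (Set.Icc a b))) :
    IsBestPoly m f (Set.Icc a b) (bestPoly m f (Set.Icc a b)) := by
  apply Classical.epsilon_spec
  have := finiteDimensional_degreeLT (m + 1)
  let K := (Polynomial.degreeLT ℝ (m + 1)).map (polyToLp a b)
  obtain ⟨v, hv, hmin⟩ := K.exists_norm_eq_iInf_of_complete_subspace
    K.complete_of_finiteDimensional hf.toLp
  obtain ⟨p, hp, rfl⟩ := hv
  refine ⟨p, mem_degreeLT_succ_iff.1 hp, fun q hq => ?_⟩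
  rw [fitError_eq_norm hf, fitError_eq_norm hf, hmin]
  refine ENNReal.ofReal_le_ofReal ?_
  exact ciInf_le (f := fun w : K => ‖hf.toLp - (w : Lp ℝ 2 (volume.restrict (Set.Icc a b)))‖)
    ⟨0, by rintro _ ⟨w, rfl⟩; positivity⟩
    ⟨polyToLp a b q, Submodule.mem_map_of_mem (mem_degreeLT_succ_iff.2 hq)⟩

lemma fitError_le_add {f g : ℝ → ℝ} {a b : ℝ}
    (hf : MemLp f 2 (volume.restrict (Set.Icc a b)))
    (hg : MemLp g 2 (volume.restrict (Set.Icc a b))) (p : Polynomial ℝ) :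
    fitError f (Set.Icc a b) p
      ≤ eLpNorm (f - g) 2 (volume.restrict (Set.Icc a b)) + fitError g (Set.Icc a b) p := by
  have h : (fun t => f t - p.eval t) = (f - g) + fun t => g t - p.eval t := by
    ext t; simp
  unfold fitError
  rw [h]
  exact eLpNorm_add_le (hf.sub hg).1 (hg.sub (memLp_eval p a b)).1 one_le_two

/-- The error of the best approximation is `1`-Lipschitz in the approximated function. -/
lemma fitError_bestPoly_le_add {f g : ℝ → ℝ} {a b : ℝ} (m : ℕ)
    (hf : MemLp f 2 (volume.restrict (Set.Icc a b)))
    (hg : MemLp g 2 (volume.restrict (Set.Icc a b))) :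
    fitError f (Set.Icc a b) (bestPoly m f (Set.Icc a b))
      ≤ eLpNorm (f - g) 2 (volume.restrict (Set.Icc a b))
        + fitError g (Set.Icc a b) (bestPoly m g (Set.Icc a b)) :=
  ((isBestPoly_bestPoly m hf).2 _ (isBestPoly_bestPoly m hg).1).trans (fitError_le_add hf hg _)

lemma frequently_of_ae_restrict_Icc {q : ℝ → Prop} {a b u v : ℝ}
    (h : ∀ᵐ t ∂(volume.restrict (Set.Icc a b)), q t) (hau : a ≤ u) (huv : u < v) (hvb : v ≤ b) :
    ∃ t ∈ Set.Ioo u v, q t := by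
  by_contra! hcon
  have h1 : ∀ᵐ t ∂(volume.restrict (Set.Ioo u v)), q t :=
    ae_restrict_of_ae_restrict_of_subset
      (Set.Ioo_subset_Icc_self.trans (Set.Icc_subset_Icc hau hvb)) h
  rw [ae_restrict_iff' measurableSet_Ioo] at h1
  have h2 : volume (Set.Ioo u v) = 0 :=
    measure_mono_null (fun t ht => show ¬ (t ∈ Set.Ioo u v → q t) from
      fun hq => hcon t ht (hq ht)) (ae_iff.1 h1)
  rw [Real.volume_Ioo, ENNReal.ofReal_eq_zero] at h2
  linarith

lemma Polynomial.eq_of_eval_ae_eq_on_Icc {p q : Polynomial ℝ} {a b : ℝ} (hab : a < b)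
    (h : ∀ᵐ t ∂(volume.restrict (Set.Icc a b)), p.eval t = q.eval t) : p = q := by
  refine Polynomial.eq_of_infinite_eval_eq p q fun hfin => ?_
  have h2 : volume (Set.Icc a b) = 0 := by
    rw [ae_restrict_iff' measurableSet_Icc] at h
    have h3 : volume {t | p.eval t = q.eval t} = 0 := hfin.measure_zero _
    have h4 := measure_union_null h3 (ae_iff.1 h)
    refine measure_mono_null (fun t ht => ?_) h4
    by_cases hpq : p.eval t = q.eval t
    · exact Or.inl hpq
    · exact Or.inr fun hh => hpq (hh ht)
  rw [Real.volume_Icc, ENNReal.ofReal_eq_zero] at h2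
  linarith

lemma polyToLp_injective {a b : ℝ} (hab : a < b) : Function.Injective (polyToLp a b) := by
  intro p q hpq
  exact Polynomial.eq_of_eval_ae_eq_on_Icc hab
    ((MemLp.toLp_eq_toLp_iff (memLp_eval p a b) (memLp_eval q a b)).1 hpq)

/-- Equivalence of norms on polynomials of bounded degree: the coefficients are controlled by the
`L²` norm on an interval of positive length. -/
lemma exists_abs_coeff_le_norm_polyToLp {a b : ℝ} (hab : a < b) (m : ℕ) :
    ∃ C : ℝ, 0 < C ∧ ∀ p : Polynomial ℝ, p.natDegree ≤ m → ∀ i : Fin (m + 1),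
      |p.coeff i| ≤ C * ‖polyToLp a b p‖ := by
  let e := Polynomial.degreeLTEquiv ℝ (m + 1)
  let T : (Fin (m + 1) → ℝ) →ₗ[ℝ] Lp ℝ 2 (volume.restrict (Set.Icc a b)) :=
    polyToLp a b ∘ₗ (Polynomial.degreeLT ℝ (m + 1)).subtype ∘ₗ e.symm.toLinearMap
  have hT : LinearMap.ker T = ⊥ := LinearMap.ker_eq_bot.2 <|
    (polyToLp_injective hab).comp (Subtype.val_injective.comp e.symm.injective)
  obtain ⟨C, hC, hanti⟩ := T.exists_antilipschitzWith hT
  refine ⟨C, hC, fun p hp i => ?_⟩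
  have h := hanti.le_mul_dist (e ⟨p, mem_degreeLT_succ_iff.2 hp⟩) 0
  have hTe : T (e ⟨p, mem_degreeLT_succ_iff.2 hp⟩) = polyToLp a b p := by simp [T]
  rw [map_zero, dist_zero_right, dist_zero_right, hTe] at h
  exact (norm_le_pi_norm (e ⟨p, mem_degreeLT_succ_iff.2 hp⟩) i).trans h

lemma exists_abs_coeff_sub_coeff_bestPoly_le {a b : ℝ} (hab : a < b) (m : ℕ) :
    ∃ C : ℝ, 0 < C ∧ ∀ f : ℝ → ℝ, MemLp f 2 (volume.restrict (Set.Icc a b)) →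
      ∀ p : Polynomial ℝ, p.natDegree ≤ m → ∀ i : Fin (m + 1),
        |p.coeff i - (bestPoly m f (Set.Icc a b)).coeff i|
          ≤ C * (fitError f (Set.Icc a b) p).toReal := by
  obtain ⟨C, hC, hcoeff⟩ := exists_abs_coeff_le_norm_polyToLp hab m
  refine ⟨2 * C, by positivity, fun f hf p hp i => ?_⟩
  obtain ⟨hdeg, hmin⟩ := isBestPoly_bestPoly m hf
  have hle := hmin p hp
  set q := bestPoly m f (Set.Icc a b)
  have h1 := hcoeff (p - q) (by simpa using Polynomial.natDegree_sub_le_of_le hp hdeg) i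
  rw [fitError_eq_norm hf, fitError_eq_norm hf,
    ENNReal.ofReal_le_ofReal_iff (norm_nonneg _)] at hle
  rw [Polynomial.coeff_sub, map_sub] at h1
  rw [fitError_eq_norm hf, ENNReal.toReal_ofReal (norm_nonneg _)]
  have h2 : ‖polyToLp a b p - polyToLp a b q‖
      ≤ ‖hf.toLp - polyToLp a b q‖ + ‖hf.toLp - polyToLp a b p‖ := by
    rw [show polyToLp a b p - polyToLp a b q
      = (hf.toLp - polyToLp a b q) - (hf.toLp - polyToLp a b p) by abel]
    exact norm_sub_le _ _
  calc _ ≤ C * ‖polyToLp a b p - polyToLp a b q‖ := h1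
    _ ≤ C * (2 * ‖hf.toLp - polyToLp a b p‖) := by gcongr; linarith
    _ = _ := by ring

/-- Polynomials are dense in `L²([a, b])`. -/
lemma exists_fitError_le {f : ℝ → ℝ} {a b : ℝ} (hf : MemLp f 2 (volume.restrict (Set.Icc a b)))
    {ε : ENNReal} (hε : ε ≠ 0) : ∃ q : Polynomial ℝ, fitError f (Set.Icc a b) q ≤ ε := by
  obtain ⟨g, hfg, hg⟩ := hf.exists_boundedContinuous_eLpNorm_sub_le ENNReal.ofNat_ne_top
    (ENNReal.half_pos hε).ne'
  set M : ENNReal := volume.restrict (Set.Icc a b) Set.univ ^ (2 : ENNReal).toReal⁻¹ with hM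
  have hMtop : M ≠ ⊤ := ENNReal.rpow_ne_top_of_nonneg (by positivity) (measure_ne_top _ _)
  obtain ⟨c, hc, hMc⟩ : ∃ c : ℝ, 0 < c ∧ M * ENNReal.ofReal c ≤ ε / 2 := by
    have hlim : Tendsto (fun c : ℝ => M * ENNReal.ofReal c) (𝓝[>] 0) (𝓝 0) := by
      have h1 : Tendsto (fun c : ℝ => ENNReal.ofReal c) (𝓝[>] 0) (𝓝 0) := by
        have h0 := ENNReal.continuous_ofReal.tendsto 0
        rw [ENNReal.ofReal_zero] at h0
        exact h0.mono_left nhdsWithin_le_nhds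
      simpa using ENNReal.Tendsto.const_mul h1 (Or.inr hMtop)
    obtain ⟨c, hc1, hc2⟩ :=
      ((hlim.eventually (gt_mem_nhds (ENNReal.half_pos hε))).and self_mem_nhdsWithin).exists
    exact ⟨c, hc2, hc1.le⟩
  obtain ⟨q, hq⟩ := exists_polynomial_near_of_continuousOn a b g g.continuous.continuousOn c hc
  refine ⟨q, (fitError_le_add hf hg q).trans ?_⟩
  rw [← ENNReal.add_halves ε]
  refine add_le_add hfg (le_trans (eLpNorm_le_of_ae_bound (C := c) ?_) hMc)
  refine (ae_restrict_iff' measurableSet_Icc).2 (Eventually.of_forall fun t ht => ?_)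
  rw [Real.norm_eq_abs, abs_sub_comm]
  exact (hq t ht).le

/-! ### Monotone functions -/

lemma Monotone.memLp_Icc {f : ℝ → ℝ} (hf : Monotone f) (a b : ℝ) :
    MemLp f 2 (volume.restrict (Set.Icc a b)) :=
  (hf.monotoneOn _).memLp_isCompact isCompact_Icc

lemma Monotone.eq_of_ae_eq_continuous {f g : ℝ → ℝ} {a b : ℝ} (hf : Monotone f)
    (hg : Continuous g) (h : ∀ᵐ t ∂(volume.restrict (Set.Icc a b)), f t = g t) {t : ℝ}
    (ht : t ∈ Set.Ioo a b) : f t = g t := by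
  refine le_antisymm (le_of_not_gt fun hlt => ?_) (le_of_not_gt fun hlt => ?_)
  · obtain ⟨δ, hδ, hball⟩ := Metric.eventually_nhds_iff.1
      ((hg.tendsto t).eventually (gt_mem_nhds hlt))
    obtain ⟨s, ⟨hs1, hs2⟩, hs⟩ := frequently_of_ae_restrict_Icc h ht.1.le
      (lt_min (lt_add_of_pos_right t hδ) ht.2) (min_le_right _ _)
    have hs3 := hs2.trans_le (min_le_left _ _)
    have h1 := hball (y := s) (by rw [Real.dist_eq, abs_lt]; constructor <;> linarith)
    linarith [hf hs1.le]
  · obtain ⟨δ, hδ, hball⟩ := Metric.eventually_nhds_iff.1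
      ((hg.tendsto t).eventually (lt_mem_nhds hlt))
    obtain ⟨s, ⟨hs1, hs2⟩, hs⟩ := frequently_of_ae_restrict_Icc h (le_max_right (t - δ) a)
      (max_lt (sub_lt_self t hδ) ht.1) ht.2.le
    have hs3 := (le_max_left _ _).trans_lt hs1
    have h1 := hball (y := s) (by rw [Real.dist_eq, abs_lt]; constructor <;> linarith)
    linarith [hf hs2.le]

/-- If `G` lies between a monotone `F` and its translate by `ε`, then the `L¹` distance on `[0, b]`
is a telescoping integral of size `O(ε)`, and the `L²` distance is `O(√ε)`. -/
lemma eLpNorm_sub_le_of_shift_le {F G : ℝ → ℝ} (hF : Monotone F) (hG : Monotone G)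
    (hG0 : ∀ t, 0 ≤ G t) (hGF : ∀ t, G t ≤ F t) {ε b : ℝ} (hε : 0 ≤ ε) (hb : 0 ≤ b)
    (hshift : ∀ t, ε ≤ t → F (t - ε) ≤ G t) :
    eLpNorm (G - F) 2 (volume.restrict (Set.Icc 0 b)) ≤ ENNReal.ofReal (F b * √ε) := by
  have hF0 : ∀ t, 0 ≤ F t := fun t => (hG0 t).trans (hGF t)
  let W : ℝ → ℝ := fun t => if 0 ≤ t then F t else 0
  have hW : Monotone W := by
    intro s t hst
    simp only [W]
    split_ifs with h1 h2
    · exact hF hst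
    · exact absurd (h1.trans hst) h2
    · exact hF0 t
    · exact le_rfl
  have hWW : Monotone fun t => W (t - ε) := fun s t hst => hW (by linarith)
  have hint : ∀ u v, IntervalIntegrable W volume u v := fun u v => hW.intervalIntegrable
  have hint' : ∀ u v, IntervalIntegrable (fun t => W (t - ε)) volume u v :=
    fun u v => hWW.intervalIntegrable
  have htel : ∫ t in (0 : ℝ)..b, (W t - W (t - ε)) ≤ F b * ε := by
    rw [intervalIntegral.integral_sub (hint _ _) (hint' _ _),
      intervalIntegral.integral_comp_sub_right,
      intervalIntegral.integral_interval_sub_interval_comm (hint _ _) (hint _ _) (hint _ _),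
      intervalIntegral.integral_symm (0 - ε) 0, intervalIntegral.integral_symm (b - ε) b]
    have h1 : 0 ≤ ∫ t in (0 - ε)..0, W t :=
      intervalIntegral.integral_nonneg (by linarith) fun t _ => by
        simp only [W]; split_ifs; exacts [hF0 t, le_rfl]
    have h2 : ∫ t in (b - ε)..b, W t ≤ ∫ _t in (b - ε)..b, F b := by
      refine intervalIntegral.integral_mono_on (by linarith) (hint _ _) (by simp) fun t ht => ?_
      simp only [W]; split_ifs; exacts [hF ht.2, hF0 b]
    rw [intervalIntegral.integral_const, smul_eq_mul] at h2
    linarith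
  have hpt : ∀ t ∈ Set.Icc 0 b, (G t - F t) ^ 2 ≤ F b * (W t - W (t - ε)) := by
    intro t ht
    have h1 : F t - G t ≤ W t - W (t - ε) := by
      simp only [W, if_pos ht.1]
      split_ifs with h
      · linarith [hshift t (by linarith)]
      · linarith [hG0 t]
    have h2 : F t - G t ≤ F b := by linarith [hG0 t, hF ht.2]
    have h3 : 0 ≤ F t - G t := by linarith [hGF t]
    calc (G t - F t) ^ 2 = (F t - G t) * (F t - G t) := by ring
      _ ≤ F b * (W t - W (t - ε)) := mul_le_mul h2 h1 h3 (hF0 b)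
  have hmem : MemLp (G - F) 2 (volume.restrict (Set.Icc 0 b)) :=
    (hG.memLp_Icc 0 b).sub (hF.memLp_Icc 0 b)
  rw [hmem.eLpNorm_eq_integral_rpow_norm two_ne_zero ENNReal.ofNat_ne_top]
  refine ENNReal.ofReal_le_ofReal ?_
  have hsq : ∫ t in Set.Icc 0 b, ‖(G - F) t‖ ^ (2 : ENNReal).toReal ≤ F b * (F b * ε) := by
    calc ∫ t in Set.Icc 0 b, ‖(G - F) t‖ ^ (2 : ENNReal).toReal
        = ∫ t in Set.Icc 0 b, (G t - F t) ^ 2 := by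
          refine integral_congr_ae (Eventually.of_forall fun t => ?_)
          simp
      _ ≤ ∫ t in Set.Icc 0 b, F b * (W t - W (t - ε)) := by
          refine setIntegral_mono_on hmem.integrable_sq ?_ measurableSet_Icc hpt
          exact (((hint 0 b).sub (hint' 0 b)).const_mul (F b)).1.mono_set_ae
            Ioc_ae_eq_Icc.symm.le
      _ = F b * ∫ t in (0 : ℝ)..b, (W t - W (t - ε)) := by
          rw [integral_const_mul, intervalIntegral.integral_of_le hb, integral_Icc_eq_integral_Ioc]
      _ ≤ _ := mul_le_mul_of_nonneg_left htel (hF0 b)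
  calc _ ≤ (F b * (F b * ε)) ^ ((2 : ENNReal).toReal)⁻¹ := by gcongr
    _ = √((F b) ^ 2 * ε) := by
        rw [Real.sqrt_eq_rpow]; norm_num; ring_nf
    _ = F b * √ε := by rw [Real.sqrt_mul (by positivity), Real.sqrt_sq (hF0 b)]

/-! ### Volume functions and the polynomial reach -/

section Volume

variable {d : ℕ} {S A : Set (EuclideanSpace ℝ (Fin d))}

lemma volFun_nonneg (S : Set (EuclideanSpace ℝ (Fin d))) (t : ℝ) : 0 ≤ volFun S t :=
  ENNReal.toReal_nonneg

lemma measure_cthickening_ne_top (hS : Bornology.IsBounded S) (t : ℝ) :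
    volume (Metric.cthickening t S) ≠ ⊤ :=
  hS.cthickening.measure_lt_top.ne

lemma volFun_mono (hS : Bornology.IsBounded S) : Monotone (volFun S) := fun _ t hst =>
  ENNReal.toReal_mono (measure_cthickening_ne_top hS t)
    (measure_mono (Metric.cthickening_mono hst S))

lemma volFun_le_of_subset (hS : Bornology.IsBounded S) (hAS : A ⊆ S) (t : ℝ) :
    volFun A t ≤ volFun S t :=
  ENNReal.toReal_mono (measure_cthickening_ne_top hS t)
    (measure_mono (Metric.cthickening_subset_of_subset t hAS))

lemma volFun_sub_le (hA : Bornology.IsBounded A) {ε t : ℝ} (hSA : S ⊆ Metric.cthickening ε A)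
    (hε : 0 ≤ ε) (ht : ε ≤ t) : volFun S (t - ε) ≤ volFun A t := by
  refine ENNReal.toReal_mono (measure_cthickening_ne_top hA t) (measure_mono ?_)
  calc Metric.cthickening (t - ε) S
      ⊆ Metric.cthickening (t - ε) (Metric.cthickening ε A) :=
        Metric.cthickening_subset_of_subset _ hSA
    _ ⊆ Metric.cthickening (t - ε + ε) A :=
        Metric.cthickening_cthickening_subset (by linarith) hε A
    _ = Metric.cthickening t A := by rw [sub_add_cancel]

lemma eLpNorm_volFun_sub_le (hS : Bornology.IsBounded S) (hAS : A ⊆ S) {ε a b c : ℝ}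
    (hSA : S ⊆ Metric.cthickening ε A) (hε : 0 ≤ ε) (ha : 0 ≤ a) (hbc : b ≤ c) (hc : 0 ≤ c) :
    eLpNorm (volFun A - volFun S) 2 (volume.restrict (Set.Icc a b))
      ≤ ENNReal.ofReal (volFun S c * √ε) :=
  (eLpNorm_mono_measure _ (Measure.restrict_mono (Set.Icc_subset_Icc ha hbc) le_rfl)).trans
    (eLpNorm_sub_le_of_shift_le (volFun_mono hS) (volFun_mono (hS.subset hAS)) (volFun_nonneg A)
      (volFun_le_of_subset hS hAS) hε hc fun _ ht => volFun_sub_le (hS.subset hAS) hSA hε ht)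

/-- Away from the origin and below the reach, the volume function is Lipschitz, so that the error
of the fit is of the order of the distance `ε` between `A` and `S`, and not only of `√ε`. -/
lemma exists_fitError_volFun_le (hS : Bornology.IsBounded S) {p : Polynomial ℝ} {a b : ℝ}
    (hp : ∀ s ∈ Set.Icc 0 b, volFun S s = p.eval s) :
    ∃ C : ℝ, 0 < C ∧ ∀ A ⊆ S, ∀ ε : ℝ, 0 ≤ ε → ε ≤ a → S ⊆ Metric.cthickening ε A →
      fitError (volFun A) (Set.Icc a b) p ≤ ENNReal.ofReal (C * ε) := by
  have hcd : ContDiff ℝ 1 fun t : ℝ => p.eval t := by simpa using p.contDiff_aeval (𝕜 := ℝ) 1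
  obtain ⟨L, hL⟩ := (hcd.locallyLipschitz.locallyLipschitzOn
    (s := Set.Icc 0 b)).exists_lipschitzOnWith_of_compact isCompact_Icc
  set M : ENNReal := volume.restrict (Set.Icc a b) Set.univ ^ (2 : ENNReal).toReal⁻¹
  have hMtop : M ≠ ⊤ := ENNReal.rpow_ne_top_of_nonneg (by positivity) (measure_ne_top _ _)
  refine ⟨M.toReal * L + 1, by positivity, fun A hAS ε hε hεa hSA => ?_⟩
  have hpt : ∀ t ∈ Set.Icc a b, ‖volFun A t - p.eval t‖ ≤ L * ε := by
    intro t ht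
    have ht0 : t ∈ Set.Icc 0 b := ⟨by linarith [ht.1], ht.2⟩
    have htε : t - ε ∈ Set.Icc 0 b := ⟨by linarith [ht.1], by linarith [ht.2]⟩
    have h1 := volFun_le_of_subset hS hAS t
    have h2 := volFun_sub_le (hS.subset hAS) hSA hε (t := t) (by linarith [ht.1])
    have h3 := hL.dist_le_mul t ht0 (t - ε) htε
    rw [hp t ht0] at h1
    rw [hp _ htε] at h2
    rw [Real.dist_eq, Real.dist_eq, sub_sub_cancel, abs_of_nonneg hε] at h3
    rw [Real.norm_eq_abs, abs_le]
    constructor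
    · linarith [le_abs_self (p.eval t - p.eval (t - ε))]
    · linarith [mul_nonneg L.coe_nonneg hε]
  calc fitError (volFun A) (Set.Icc a b) p ≤ M * ENNReal.ofReal (L * ε) :=
        eLpNorm_le_of_ae_bound
          ((ae_restrict_iff' measurableSet_Icc).2 (Eventually.of_forall hpt))
    _ = ENNReal.ofReal (M.toReal * (L * ε)) := by
        rw [ENNReal.ofReal_mul ENNReal.toReal_nonneg, ENNReal.ofReal_toReal hMtop]
    _ ≤ _ := ENNReal.ofReal_le_ofReal (by linarith)

lemma exists_polynomial_of_lt_polyReach {a : ℝ} (h : (a : EReal) < polyReach S) :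
    ∃ t : ℝ, a < t ∧ ∃ p : Polynomial ℝ, p.natDegree ≤ d ∧
      ∀ s ∈ Set.Icc 0 t, volFun S s = p.eval s := by
  obtain ⟨_, ⟨t, ⟨-, hp⟩, rfl⟩, hat⟩ := lt_sSup_iff.1 h
  exact ⟨t, EReal.coe_lt_coe_iff.1 hat, hp⟩

lemma le_polyReach {p : Polynomial ℝ} (hpd : p.natDegree ≤ d) {t : ℝ} (ht : 0 ≤ t)
    (hp : ∀ s ∈ Set.Icc 0 t, volFun S s = p.eval s) : (t : EReal) ≤ polyReach S :=
  le_sSup ⟨t, ⟨ht, p, hpd, hp⟩, rfl⟩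

/-- A polynomial that represents the volume function on some `[0, t₀]`, `t₀ > 0`, represents it up
to the polynomial reach. -/
lemma volFun_eq_eval_of_lt_polyReach {p : Polynomial ℝ} {t₀ : ℝ} (ht₀ : 0 < t₀)
    (hp : ∀ s ∈ Set.Icc 0 t₀, volFun S s = p.eval s) {s : ℝ} (hs0 : 0 ≤ s)
    (hs : (s : EReal) < polyReach S) : volFun S s = p.eval s := by
  obtain ⟨t, hst, q, -, hq⟩ := exists_polynomial_of_lt_polyReach hs
  have hpq : p = q := by
    refine Polynomial.eq_of_eval_ae_eq_on_Icc (lt_min ht₀ (hs0.trans_lt hst))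
      ((ae_restrict_iff' measurableSet_Icc).2 (Eventually.of_forall fun u hu => ?_))
    rw [← hp u ⟨hu.1, hu.2.trans (min_le_left _ _)⟩, hq u ⟨hu.1, hu.2.trans (min_le_right _ _)⟩]
  rw [hpq, hq s ⟨hs0, hst.le⟩]

/-- Polynomials that agree on an interval are equal: if the volume function is a polynomial, of
whatever degree, a.e. on an interval `[a, b]` that starts below the reach, then the reach is at
least `b`. -/
lemma le_polyReach_of_ae_eq (hS : Bornology.IsBounded S) {p q : Polynomial ℝ}
    (hpd : p.natDegree ≤ d) {t₀ a b : ℝ} (ha : 0 ≤ a) (hat : a < t₀) (hab : a < b)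
    (hp : ∀ s ∈ Set.Icc 0 t₀, volFun S s = p.eval s)
    (hq : ∀ᵐ s ∂(volume.restrict (Set.Icc a b)), volFun S s = q.eval s) :
    (b : EReal) ≤ polyReach S := by
  have hqp : q = p := by
    refine Polynomial.eq_of_eval_ae_eq_on_Icc (lt_min hat hab) ?_
    filter_upwards [ae_restrict_of_ae_restrict_of_subset
      (Set.Icc_subset_Icc le_rfl (min_le_right t₀ b)) hq, ae_restrict_mem measurableSet_Icc]
      with s hs hsI
    rw [← hs, hp s ⟨ha.trans hsI.1, hsI.2.trans (min_le_left _ _)⟩]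
  subst hqp
  refine le_of_forall_lt fun c hc => ?_
  obtain ⟨t, hct, htb⟩ := EReal.lt_iff_exists_real_btwn.1
    (max_lt hc (EReal.coe_lt_coe_iff.2 hab))
  have hat' : a < t := by exact_mod_cast (le_max_right _ _).trans_lt hct
  have htb' : t < b := by exact_mod_cast htb
  refine ((le_max_left _ _).trans_lt hct).trans_le
    (le_polyReach hpd (ha.trans hat'.le) fun s hs => ?_)
  rcases le_or_gt s t₀ with hst | hst
  · exact hp s ⟨hs.1, hst⟩
  · exact (volFun_mono hS).eq_of_ae_eq_continuous q.continuous hq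
      ⟨hat.trans hst, hs.2.trans_lt htb'⟩

lemma fitError_bestPoly_ne_zero (hS : Bornology.IsBounded S) {p : Polynomial ℝ}
    (hpd : p.natDegree ≤ d) {t₀ a b : ℝ} (ha : 0 ≤ a) (hat : a < t₀) (hab : a < b)
    (hp : ∀ s ∈ Set.Icc 0 t₀, volFun S s = p.eval s) (hb : polyReach S < (b : EReal)) (m : ℕ) :
    fitError (volFun S) (Set.Icc a b) (bestPoly m (volFun S) (Set.Icc a b)) ≠ 0 := by
  intro h0
  refine hb.not_ge (le_polyReach_of_ae_eq hS hpd ha hat hab hp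
    (q := bestPoly m (volFun S) (Set.Icc a b)) ?_)
  rw [fitError_eq_eLpNorm_sub, eLpNorm_eq_zero_iff
    (((volFun_mono hS).memLp_Icc a b).sub (memLp_eval _ a b)).1 two_ne_zero] at h0
  filter_upwards [h0] with s hs
  exact sub_eq_zero.1 hs

lemma fitError_eq_eLpNorm_volFun_sub {f : ℝ → ℝ} {p : Polynomial ℝ} {a b t₀ : ℝ} (ha : 0 ≤ a)
    (hb : b ≤ t₀) (hp : ∀ s ∈ Set.Icc 0 t₀, volFun S s = p.eval s) :
    fitError f (Set.Icc a b) p = eLpNorm (f - volFun S) 2 (volume.restrict (Set.Icc a b)) := by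
  refine eLpNorm_congr_ae ?_
  filter_upwards [ae_restrict_mem measurableSet_Icc] with s hs
  rw [Pi.sub_apply, hp s ⟨ha.trans hs.1, hs.2.trans hb⟩]

end Volume

/-! ### The algorithm -/

lemma grid_lt {K : ℕ} {r : ℕ → ℝ} (hr : ∀ i < K, r i < r (i + 1)) {i j : ℕ} (hij : i < j)
    (hj : j ≤ K) : r i < r j := by
  induction j, hij using Nat.le_induction with
  | base => exact hr i hj
  | succ k hk ih => exact (ih (by omega)).trans (hr k (by omega))

lemma exists_algOutput_eq {d l K i₀ : ℕ} {r : ℕ → ℝ} {U : ℝ} {f : ℝ → ℝ} (hi₀ : 2 ≤ i₀)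
    (hi₀K : i₀ < K)
    (hU : fitError f (Set.Icc 0 (r 1)) (bestPoly d f (Set.Icc 0 (r 1))) ≤ ENNReal.ofReal U)
    (hle : ∀ i ∈ Finset.Icc 1 2, algRatio d l K r f i ≤ 1)
    (hgt : i₀ + 1 < K → 1 < algRatio d l K r f (i₀ + 1)) :
    ∃ j ∈ Finset.Icc 2 i₀, algOutput d l K r U f = r j := by
  classical
  rw [algOutput, if_neg hU.not_gt]
  split_ifs with h
  · obtain ⟨h1, hK, hratio⟩ := Nat.find_spec h
    refine ⟨_, Finset.mem_Icc.2 ⟨?_, ?_⟩, rfl⟩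
    · by_contra! hlt
      exact (hle (Nat.find h) (Finset.mem_Icc.2 ⟨h1, by omega⟩)).not_gt hratio
    · rcases lt_or_ge (i₀ + 1) K with hlt | hge
      · have := Nat.find_min' h ⟨by omega, hlt, hgt hlt⟩
        omega
      · omega
  · refine ⟨_, Finset.mem_Icc.2 ⟨?_, ?_⟩, rfl⟩
    · omega
    · by_contra! hlt
      exact h ⟨i₀ + 1, by omega, by omega, hgt (by omega)⟩

section Algorithm

variable {d : ℕ} {S : Set (EuclideanSpace ℝ (Fin d))} {A : ℕ → Set (EuclideanSpace ℝ (Fin d))}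
  {ε : ℕ → ℝ} {K i₀ : ℕ} {r : ℕ → ℝ}

lemma tendsto_ofReal_mul_sqrt_zero (c : ℝ) (hεlim : Tendsto ε atTop (𝓝 0)) :
    Tendsto (fun n => ENNReal.ofReal (c * √(ε n))) atTop (𝓝 0) := by
  have h : Tendsto (fun n => c * √(ε n)) atTop (𝓝 0) := by
    simpa using (((Real.continuous_sqrt.tendsto 0).comp hεlim).const_mul c)
  simpa [Function.comp_def] using (ENNReal.continuous_ofReal.tendsto 0).comp h

/-- Below the reach the numerator of the ratio tends to `0`, while the denominator stays away from
`0` because the volume function is not a polynomial on `[r i, r K]`. -/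
lemma eventually_algRatio_le_one (hS : Bornology.IsBounded S) (hr0 : r 0 = 0)
    (hr : ∀ i < K, r i < r (i + 1)) (hε0 : ∀ n, 0 ≤ ε n) (hεlim : Tendsto ε atTop (𝓝 0))
    (hA : ∀ᶠ n in atTop, A n ⊆ S ∧ S ⊆ Metric.cthickening (ε n) (A n)) {p : Polynomial ℝ}
    (hpd : p.natDegree ≤ d) {t₀ : ℝ} (hp : ∀ s ∈ Set.Icc 0 t₀, volFun S s = p.eval s)
    (hRup : polyReach S < (r K : EReal)) (l : ℕ) {i : ℕ} (hi : 0 < i) (hiK : i < K)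
    (hit : r i < t₀) :
    ∀ᶠ n in atTop, algRatio d l K r (volFun (A n)) i ≤ 1 := by
  have hri : 0 < r i := hr0 ▸ grid_lt hr hi hiK.le
  have hriK : r i < r K := grid_lt hr hiK le_rfl
  have hne := fitError_bestPoly_ne_zero hS hpd hri.le hit hriK hp hRup l
  have hlim := tendsto_ofReal_mul_sqrt_zero (volFun S (r K)) hεlim
  have hlim2 := hlim.add hlim
  rw [add_zero] at hlim2
  filter_upwards [hA, hlim2.eventually (gt_mem_nhds (pos_iff_ne_zero.2 hne))]
    with n ⟨hAS, hSA⟩ hsmall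
  have hmono := volFun_mono (hS.subset hAS)
  have hnum := ((isBestPoly_bestPoly d (hmono.memLp_Icc 0 (r i))).2 p hpd).trans
    ((fitError_eq_eLpNorm_volFun_sub le_rfl hit.le hp).trans_le
      (eLpNorm_volFun_sub_le hS hAS hSA (hε0 n) le_rfl hriK.le (hri.trans hriK).le))
  have hden := fitError_bestPoly_le_add l ((volFun_mono hS).memLp_Icc (r i) (r K))
    (hmono.memLp_Icc (r i) (r K))
  have hD := eLpNorm_volFun_sub_le hS hAS hSA (hε0 n) hri.le (le_refl (r K)) (hri.trans hriK).le
  rw [eLpNorm_sub_comm] at hD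
  refine ENNReal.div_le_of_le_mul ?_
  rw [one_mul]
  refine hnum.trans (lt_of_add_lt_add_left (hsmall.trans_le (hden.trans ?_))).le
  gcongr

/-- If the fits to the volume function itself satisfy a strict inequality, then so do those to its
approximations. -/
lemma eventually_one_lt_algRatio (hS : Bornology.IsBounded S) {l i : ℕ} (hri : 0 ≤ r i)
    (hriK : r i ≤ r K) (hε0 : ∀ n, 0 ≤ ε n) (hεlim : Tendsto ε atTop (𝓝 0))
    (hA : ∀ᶠ n in atTop, A n ⊆ S ∧ S ⊆ Metric.cthickening (ε n) (A n))
    (hlt : fitError (volFun S) (Set.Icc (r i) (r K)) (bestPoly l (volFun S) (Set.Icc (r i) (r K)))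
      < fitError (volFun S) (Set.Icc 0 (r i)) (bestPoly d (volFun S) (Set.Icc 0 (r i)))) :
    ∀ᶠ n in atTop, 1 < algRatio d l K r (volFun (A n)) i := by
  have hlim := tendsto_ofReal_mul_sqrt_zero (volFun S (r K)) hεlim
  have hlim2 := hlim.add (hlim.add_const
    (fitError (volFun S) (Set.Icc (r i) (r K)) (bestPoly l (volFun S) (Set.Icc (r i) (r K)))))
  rw [zero_add, zero_add] at hlim2
  filter_upwards [hA, hlim2.eventually (gt_mem_nhds hlt)] with n ⟨hAS, hSA⟩ hsmall
  have hmono := volFun_mono (hS.subset hAS)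
  have hnum := fitError_bestPoly_le_add d ((volFun_mono hS).memLp_Icc 0 (r i))
    (hmono.memLp_Icc 0 (r i))
  have hden := fitError_bestPoly_le_add l (hmono.memLp_Icc (r i) (r K))
    ((volFun_mono hS).memLp_Icc (r i) (r K))
  have hD1 := eLpNorm_volFun_sub_le hS hAS hSA (hε0 n) le_rfl hriK (hri.trans hriK)
  have hD2 := eLpNorm_volFun_sub_le hS hAS hSA (hε0 n) hri (le_refl (r K)) (hri.trans hriK)
  rw [eLpNorm_sub_comm] at hD1
  have hmain : fitError (volFun (A n)) (Set.Icc (r i) (r K))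
        (bestPoly l (volFun (A n)) (Set.Icc (r i) (r K)))
      < fitError (volFun (A n)) (Set.Icc 0 (r i))
        (bestPoly d (volFun (A n)) (Set.Icc 0 (r i))) := by
    refine (hden.trans (by gcongr)).trans_lt
      (lt_of_add_lt_add_left (hsmall.trans_le (hnum.trans ?_)))
    gcongr
  rw [algRatio, ENNReal.lt_div_iff_mul_lt
    (Or.inr ENNReal.one_ne_top) (Or.inr one_ne_zero), one_mul]
  exact hmain

/-- The algorithm eventually returns one of the grid points `r 2, …, r i₀`. -/
lemma eventually_exists_algOutput_eq (hS : Bornology.IsBounded S) (hr0 : r 0 = 0)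
    (hr : ∀ i < K, r i < r (i + 1)) (hi₀ : 2 ≤ i₀) (hi₀K : i₀ < K)
    (hε0 : ∀ n, 0 ≤ ε n) (hεlim : Tendsto ε atTop (𝓝 0))
    (hA : ∀ᶠ n in atTop, A n ⊆ S ∧ S ⊆ Metric.cthickening (ε n) (A n)) {p : Polynomial ℝ}
    (hpd : p.natDegree ≤ d) {t₀ : ℝ} (hp : ∀ s ∈ Set.Icc 0 t₀, volFun S s = p.eval s)
    (ht₀ : r i₀ < t₀) (hRup : polyReach S < (r K : EReal)) {l : ℕ} {U : ℕ → ℝ}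
    (hU : ∀ᶠ n in atTop, volFun S (r K) * √(ε n) ≤ U n)
    (hl : i₀ + 1 < K →
      fitError (volFun S) (Set.Icc (r (i₀ + 1)) (r K))
          (bestPoly l (volFun S) (Set.Icc (r (i₀ + 1)) (r K)))
        < fitError (volFun S) (Set.Icc 0 (r (i₀ + 1)))
          (bestPoly d (volFun S) (Set.Icc 0 (r (i₀ + 1))))) :
    ∀ᶠ n in atTop, ∃ j ∈ Finset.Icc 2 i₀,
      algOutput d l K r (U n) (volFun (A n)) = r j := by
  have hrle : ∀ i ≤ i₀, r i ≤ r i₀ := fun i hi => by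
    rcases hi.lt_or_eq with h | rfl
    · exact (grid_lt hr h hi₀K.le).le
    · exact le_rfl
  have hle : ∀ᶠ n in atTop, ∀ i ∈ Finset.Icc 1 2, algRatio d l K r (volFun (A n)) i ≤ 1 := by
    rw [eventually_all_finset]
    intro i hi
    rw [Finset.mem_Icc] at hi
    exact eventually_algRatio_le_one hS hr0 hr hε0 hεlim hA hpd hp hRup l (by omega) (by omega)
      ((hrle i (by omega)).trans_lt ht₀)
  have hgt : ∀ᶠ n in atTop, i₀ + 1 < K → 1 < algRatio d l K r (volFun (A n)) (i₀ + 1) := by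
    rw [eventually_imp_distrib_left]
    intro h
    have h0 : 0 < r (i₀ + 1) := hr0 ▸ grid_lt hr (Nat.succ_pos _) h.le
    exact eventually_one_lt_algRatio hS h0.le (grid_lt hr h le_rfl).le hε0 hεlim hA (hl h)
  filter_upwards [hA, hU, hle, hgt] with n ⟨hAS, hSA⟩ hUn hlen hgtn
  refine exists_algOutput_eq hi₀ hi₀K ?_ hlen hgtn
  have h1K : r 1 < r K := grid_lt hr (by omega) le_rfl
  have h01 : r 0 < r 1 := hr 0 (by omega)
  calc _ ≤ fitError (volFun (A n)) (Set.Icc 0 (r 1)) p :=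
        (isBestPoly_bestPoly d ((volFun_mono (hS.subset hAS)).memLp_Icc 0 (r 1))).2 p hpd
    _ ≤ ENNReal.ofReal (volFun S (r K) * √(ε n)) :=
        (fitError_eq_eLpNorm_volFun_sub le_rfl ((hrle 1 (by omega)).trans ht₀.le) hp).trans_le
          (eLpNorm_volFun_sub_le hS hAS hSA (hε0 n) le_rfl h1K.le (by linarith))
    _ ≤ _ := ENNReal.ofReal_le_ofReal hUn

/-- On each of finitely many windows `[r 1, r j]`, the fitted coefficients are within `O(ε)` of
those of the volume function. -/
lemma exists_abs_coeff_sub_coeff_bestPoly_volFun_le (hS : Bornology.IsBounded S)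
    (hr : ∀ i < K, r i < r (i + 1)) (hi₀K : i₀ < K) {p : Polynomial ℝ} (hpd : p.natDegree ≤ d)
    (hp : ∀ s ∈ Set.Icc 0 (r i₀), volFun S s = p.eval s) :
    ∃ C : ℝ, 0 < C ∧ ∀ j ∈ Finset.Icc 2 i₀, ∀ A ⊆ S, ∀ ε : ℝ, 0 ≤ ε → ε ≤ r 1 →
      S ⊆ Metric.cthickening ε A → ∀ i : Fin (d + 1),
        |p.coeff i - (bestPoly d (volFun A) (Set.Icc (r 1) (r j))).coeff i| ≤ C * ε := by
  have hj : ∀ j ∈ Finset.Icc 2 i₀, ∃ C : ℝ, 0 < C ∧ ∀ A ⊆ S, ∀ ε : ℝ, 0 ≤ ε → ε ≤ r 1 →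
      S ⊆ Metric.cthickening ε A → ∀ i : Fin (d + 1),
        |p.coeff i - (bestPoly d (volFun A) (Set.Icc (r 1) (r j))).coeff i| ≤ C * ε := by
    intro j hj
    rw [Finset.mem_Icc] at hj
    have hji : r j ≤ r i₀ := by
      rcases hj.2.lt_or_eq with h | rfl
      · exact (grid_lt hr h hi₀K.le).le
      · exact le_rfl
    obtain ⟨C₁, hC₁, h₁⟩ := exists_abs_coeff_sub_coeff_bestPoly_le
      (grid_lt hr (show 1 < j by omega) (by omega)) d
    obtain ⟨C₂, hC₂, h₂⟩ := exists_fitError_volFun_le hS (a := r 1) (b := r j)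
      fun s hs => hp s ⟨hs.1, hs.2.trans hji⟩
    refine ⟨C₁ * C₂, by positivity, fun A hAS ε hε hε1 hSA i => ?_⟩
    refine (h₁ _ ((volFun_mono (hS.subset hAS)).memLp_Icc _ _) p hpd i).trans ?_
    rw [mul_assoc]
    exact mul_le_mul_of_nonneg_left
      (ENNReal.toReal_le_of_le_ofReal (by positivity) (h₂ A hAS ε hε hε1 hSA)) hC₁.le
  choose! C hC h using hj
  refine ⟨∑ j ∈ Finset.Icc 2 i₀, C j + 1,
    add_pos_of_nonneg_of_pos (Finset.sum_nonneg fun j hj => (hC j hj).le) one_pos,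
    fun j hj A hAS ε hε hε1 hSA i => (h j hj A hAS ε hε hε1 hSA i).trans ?_⟩
  refine mul_le_mul_of_nonneg_right ?_ hε
  linarith [Finset.single_le_sum (f := C) (fun k hk => (hC k hk).le) hj]

end Algorithm

/-- The error `O(√ε)` of the fit on `[0, r 1]`, for `ε` of order `(log n / n) ^ (1 / k)` with
`k ≤ d`, is eventually below the threshold. -/
lemma eventually_mul_sqrt_le_algThreshold {d k : ℕ} (hk : 0 < k) (hkd : k ≤ d) {η : ℝ}
    (hη : 0 < η) (M : ℝ) {C : ℝ} (hC : 0 < C) :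
    ∀ᶠ n : ℕ in atTop, M * √(C * (Real.log n / n) ^ (1 / (k : ℝ))) ≤ algThreshold d η n := by
  have h1 := (tendsto_log_div_rpow_zero one_pos).eventually (gt_mem_nhds one_pos)
  have h2 : ∀ᶠ n : ℕ in atTop, M * √C * (Real.log n / n) ^ η < 1 := by
    have := (tendsto_log_div_rpow_zero hη).const_mul (M * √C)
    rw [mul_zero] at this
    exact this.eventually (gt_mem_nhds one_pos)
  filter_upwards [h1, h2, eventually_ge_atTop 2] with n hn1 hn2 hn
  have hx := log_div_pos hn
  rw [algThreshold]
  set x := Real.log n / n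
  rw [Real.rpow_one] at hn1
  have hkR : (0 : ℝ) < k := by exact_mod_cast hk
  have hkdR : (k : ℝ) ≤ d := by exact_mod_cast hkd
  have hsqrt : √(C * x ^ (1 / (k : ℝ))) = √C * x ^ (1 / (2 * (k : ℝ))) := by
    rw [Real.sqrt_mul hC.le, Real.sqrt_eq_rpow (x ^ _), ← Real.rpow_mul hx.le]
    congr 2
    field_simp
  have hpow : x ^ (1 / (2 * (k : ℝ))) ≤ x ^ (1 / (2 * (d : ℝ))) :=
    Real.rpow_le_rpow_of_exponent_ge hx hn1.le
      (one_div_le_one_div_of_le (by positivity) (by linarith))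
  have hsplit : x ^ (1 / (2 * (d : ℝ))) = x ^ η * x ^ (1 / (2 * (d : ℝ)) - η) := by
    rw [← Real.rpow_add hx]; congr 1; ring
  have hpos : 0 ≤ x ^ (1 / (2 * (d : ℝ)) - η) := by positivity
  rw [hsqrt]
  rcases le_or_gt M 0 with hM | hM
  · exact (mul_nonpos_of_nonpos_of_nonneg hM (by positivity)).trans hpos
  · calc M * (√C * x ^ (1 / (2 * (k : ℝ)))) ≤ M * (√C * x ^ (1 / (2 * (d : ℝ)))) := by gcongr
      _ = (M * √C * x ^ η) * x ^ (1 / (2 * (d : ℝ)) - η) := by rw [hsplit]; ring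
      _ ≤ 1 * x ^ (1 / (2 * (d : ℝ)) - η) := by gcongr
      _ = _ := one_mul _

/-- Polynomials being dense in `L²`, the error of the best approximation of every
sufficiently large degree is below any given nonzero bound. -/
lemma exists_forall_fitError_bestPoly_lt {f : ℝ → ℝ} {a b : ℝ}
    (hf : MemLp f 2 (volume.restrict (Set.Icc a b))) {e : ENNReal} (he : e ≠ 0) (he' : e ≠ ⊤) :
    ∃ l₀ : ℕ, ∀ l ≥ l₀, fitError f (Set.Icc a b) (bestPoly l f (Set.Icc a b)) < e := by
  obtain ⟨q, hq⟩ := exists_fitError_le hf (ENNReal.half_pos he).ne'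
  exact ⟨q.natDegree, fun l hl => (((isBestPoly_bestPoly l hf).2 q hl).trans hq).trans_lt
    (ENNReal.half_lt_self he he')⟩

/-! ### Rate of convergence of the coefficients -/

theorem mainTheorem5 {d d' : ℕ} (hd'pos : 0 < d') (hd'd : d' ≤ d)
    (S : Set (EuclideanSpace ℝ (Fin d))) (hS : IsCompact S) (hdim : dimH S = (d' : ENNReal))
    {Ω : Type*} [MeasurableSpace Ω] (P : Measure Ω) [IsProbabilityMeasure P]
    (X : ℕ → Ω → EuclideanSpace ℝ (Fin d)) (hXmeas : ∀ n, Measurable (X n))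
    (hXindep : iIndepFun X P) (hXident : ∀ n, IdentDistrib (X n) (X 0) P P)
    (hsupp : (P.map (X 0)).support = S) (hstd : IsStandard S (P.map (X 0)) d')
    (K : ℕ) (r : ℕ → ℝ) (hr0 : r 0 = 0) (hr : ∀ i < K, r i < r (i + 1))
    (i₀ : ℕ) (hi₀ : 2 ≤ i₀) (hi₀K : i₀ < K)
    (hRlow : (r i₀ : EReal) < polyReach S) (hRup : polyReach S < (r (i₀ + 1) : EReal)) :
    ∃ θ : Fin (d + 1) → ℝ,
      (∀ t : ℝ, 0 ≤ t → (t : EReal) < polyReach S →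
        volFun S t = ∑ i : Fin (d + 1), θ i * t ^ (i : ℕ)) ∧
      ∃ l₀ : ℕ, d ≤ l₀ ∧ ∀ l : ℕ, l₀ ≤ l → ∀ η : ℝ, 0 < η →
        ∀ᵐ ω ∂P,
          (fun n : ℕ => ⨆ i : Fin (d + 1), |θ i - (fittedPoly X l K r η n ω).coeff (i : ℕ)|)
            =O[atTop] (fun n : ℕ => (Real.log n / n) ^ (1 / (d' : ℝ))) := by
  have hSb := hS.isBounded
  have hri₀ : 0 < r i₀ := hr0 ▸ grid_lt hr (by omega) hi₀K.le
  have hr1 : 0 < r 1 := hr0 ▸ hr 0 (by omega)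
  have hr0' : r i₀ < r (i₀ + 1) := hr i₀ hi₀K
  obtain ⟨t₀, ht₀, p, hpd, hp⟩ := exists_polynomial_of_lt_polyReach hRlow
  have ht₀pos := hri₀.trans ht₀
  have hRK : polyReach S < (r K : EReal) := by
    rcases (Nat.succ_le_of_lt hi₀K).lt_or_eq with h | h
    · exact hRup.trans (EReal.coe_lt_coe_iff.2 (grid_lt hr h le_rfl))
    · rwa [← h]
  refine ⟨fun i => p.coeff i, fun t ht htR => ?_, ?_⟩
  · rw [volFun_eq_eval_of_lt_polyReach ht₀pos hp ht htR,
      Polynomial.eval_eq_sum_range' (Nat.lt_succ_of_le hpd), Finset.sum_range]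
  have hne := fitError_bestPoly_ne_zero hSb hpd le_rfl ht₀pos (hri₀.trans hr0') hp hRup d
  obtain ⟨l₀, hl₀⟩ := exists_forall_fitError_bestPoly_lt
    ((volFun_mono hSb).memLp_Icc (r (i₀ + 1)) (r K)) hne
    (fitError_ne_top ((volFun_mono hSb).memLp_Icc 0 (r (i₀ + 1))) _)
  refine ⟨max d l₀, le_max_left _ _, fun l hl η hη => ?_⟩
  obtain ⟨C, hC, hcover⟩ :=
    ae_eventually_subset_cthickening_sampleSet hXmeas hXindep hXident hd'pos hstd
  obtain ⟨B, hB, hcoeff⟩ := exists_abs_coeff_sub_coeff_bestPoly_volFun_le hSb hr hi₀K hpd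
    fun s hs => hp s ⟨hs.1, hs.2.trans ht₀.le⟩
  set ε : ℕ → ℝ := fun n => C * (Real.log n / n) ^ (1 / (d' : ℝ)) with hε
  have hx0 : ∀ n : ℕ, 0 ≤ (Real.log n / n) ^ (1 / (d' : ℝ)) := fun n => by
    have := Real.log_natCast_nonneg n
    positivity
  have hε0 : ∀ n, 0 ≤ ε n := fun n => mul_nonneg hC.le (hx0 n)
  have hεlim : Tendsto ε atTop (𝓝 0) := by
    simpa [hε] using (tendsto_log_div_rpow_zero (s := 1 / (d' : ℝ)) (by positivity)).const_mul C
  filter_upwards [hcover, ae_sampleSet_subset hXmeas hXident hsupp] with ω hω hωS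
  have hout := eventually_exists_algOutput_eq (A := fun n => sampleSet X n ω) hSb hr0 hr hi₀ hi₀K
    hε0 hεlim (hω.mono fun n hn => ⟨hωS n, hn⟩) hpd hp ht₀ hRK
    (eventually_mul_sqrt_le_algThreshold hd'pos hd'd hη (volFun S (r K)) hC)
    fun _ => hl₀ l ((le_max_right _ _).trans hl)
  refine IsBigO.of_bound (B * C) ?_
  filter_upwards [hω, hout, hεlim.eventually (gt_mem_nhds hr1)] with n hn ⟨j, hj, hjeq⟩ hn1
  have hfit : fittedPoly X l K r η n ω
      = bestPoly d (volFun (sampleSet X n ω)) (Set.Icc (r 1) (r j)) := by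
    rw [fittedPoly, reachEstimate, hjeq]
  rw [Real.norm_of_nonneg (Real.iSup_nonneg fun i => abs_nonneg _), Real.norm_of_nonneg (hx0 n),
    mul_assoc, hfit]
  exact ciSup_le fun i => hcoeff j hj _ (hωS n) (ε n) (hε0 n) hn1.le hn i
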